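/- Let $\Gamma$ be a group with a finite generating set $X$, and let $|g|$ denote the word length of $g\in\Gamma$ with respect to $X$, i.e. the least length of a word in the letters $X\cup X^{-1}$ that represents $g$. The conjugacy length function of $\Gamma$ with respect to $X$ is $$\mathrm{CLF}_\Gamma(n)=\max\bigl\{\min\{|w| : w\in\Gamma,\ wu=vw\} : u,v\in\Gamma \text{ conjugate in } \Gamma,\ |u|+|v|\le n\bigr\},\qquad n\in\mathbb{N}.$$ Let $M=(m_{ij})$ be a $d\times d$ matrix with integer entries that is diagonalisable over $\mathbb{C}$ and all of whose complex eigenvalues have absolute value greater than $1$. Let $$\Gamma_M=\langle t,a_1,\ldots,a_d \mid [a_i,a_j]=1,\ ta_it^{-1}=\varphi_M(a_i)\ (i,j=1,\ldots,d)\rangle,\qquad \varphi_M(a_i)=a_1^{m_{1i}}\cdots a_d^{m_{di}},$$ with the generating set $\{t,a_1,\ldots,a_d\}$. Then there is a constant $C$, depending on $M$, such that $$\mathrm{CLF}_{\Gamma_M}(n)\le Cn\qquad\text{for all } n\in\mathbb{N}.$$ In particular, for every integer $m$ with $|m|>1$ there is a constant $C$, depending on $m$, such that the solvable Baumslag–Solitar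 group $BS(1,m)=\langle t,a\mid tat^{-1}=a^m\rangle$, with the generating set $\{t,a\}$, satisfies $\mathrm{CLF}_{BS(1,m)}(n)\le Cn$ for all $n\in\mathbb{N}$. -/

import Mathlib

/-- The word length of `g` with respect to a set `S` of generators: the least length of a word in
the letters `S ∪ S⁻¹` that represents `g` (it is `⊤` if there is no such word, which never happens
when `S` generates the group). -/
noncomputable def wordLength {G : Type*} [Group G] (S : Set G) (g : G) : ℕ∞ :=
  ⨅ (l : List G) (_ : (∀ x ∈ l, x ∈ S ∨ x⁻¹ ∈ S) ∧ l.prod = g), (l.length : ℕ∞)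

/-- The conjugacy length function of `G` with respect to `S`:
`n ↦ max { min { |w| : w u = v w } : |u| + |v| ≤ n and u is conjugate to v in G }`.
The values are taken in `ℕ∞`, so that no finiteness is presupposed. -/
noncomputable def conjugacyLengthFunction {G : Type*} [Group G] (S : Set G) (n : ℕ) : ℕ∞ :=
  ⨆ (u : G) (v : G) (_ : IsConj u v ∧ wordLength S u + wordLength S v ≤ (n : ℕ∞)),
    ⨅ (w : G) (_ : w * u = v * w), wordLength S w

/-- A square matrix over a field is diagonalisable if it has a basis of eigenvectors
(the columns of `P`). -/
def Matrix.IsDiagonalisable {K ι : Type*} [Field K] [Fintype ι] [DecidableEq ι]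
    (A : Matrix ι ι K) : Prop :=
  ∃ (P : Matrix ι ι K) (D : ι → K), IsUnit P ∧ A * P = P * Matrix.diagonal D

namespace AbByCyclic

/-- The free generators `t, a_1, …, a_d`: `none` is the letter `t` and `some i` the letter `a_i`. -/
abbrev Letter (d : ℕ) : Type := Option (Fin d)

/-- The letter `t`, in the free group. -/
def t (d : ℕ) : FreeGroup (Letter d) := FreeGroup.of none

/-- The letter `a_i`, in the free group. -/
def a {d : ℕ} (i : Fin d) : FreeGroup (Letter d) := FreeGroup.of (some i)

/-- The word `φ_M(a_i) = a_1 ^ m_{1i} ⋯ a_d ^ m_{di}`. -/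
def phi {d : ℕ} (M : Matrix (Fin d) (Fin d) ℤ) (i : Fin d) : FreeGroup (Letter d) :=
  (List.ofFn fun j : Fin d => a j ^ M j i).prod

/-- The relators of `Γ_M`, expressing `[a_i, a_j] = 1` and `t a_i t⁻¹ = φ_M(a_i)`. -/
def relators {d : ℕ} (M : Matrix (Fin d) (Fin d) ℤ) : Set (FreeGroup (Letter d)) :=
  {r | ∃ i j : Fin d, r = a i * a j * (a i)⁻¹ * (a j)⁻¹} ∪
    {r | ∃ i : Fin d, r = t d * a i * (t d)⁻¹ * (phi M i)⁻¹}

/-- The group `Γ_M = ⟨t, a_1, …, a_d ∣ [a_i, a_j] = 1, t a_i t⁻¹ = φ_M(a_i)⟩`. -/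
abbrev Gam {d : ℕ} (M : Matrix (Fin d) (Fin d) ℤ) : Type := PresentedGroup (relators M)

/-- The generating set `{t, a_1, …, a_d}` of `Γ_M`. -/
def generators {d : ℕ} (M : Matrix (Fin d) (Fin d) ℤ) : Set (Gam M) :=
  Set.range (PresentedGroup.of : Letter d → Gam M)

end AbByCyclic

namespace BaumslagSolitar

/-- The single relator of the presentation `⟨t, a ∣ t a t⁻¹ = a ^ m⟩`, where the letter `t` is
`true` and the letter `a` is `false`. -/
def relators (m : ℤ) : Set (FreeGroup Bool) :=
  {FreeGroup.of true * FreeGroup.of false * (FreeGroup.of true)⁻¹ * (FreeGroup.of false ^ m)⁻¹}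

/-- The Baumslag–Solitar group `BS(1, m) = ⟨t, a ∣ t a t⁻¹ = a ^ m⟩`. -/
abbrev BS (m : ℤ) : Type := PresentedGroup (relators m)

/-- The generating set `{t, a}` of `BS(1, m)`. -/
def generators (m : ℤ) : Set (BS m) := Set.range (PresentedGroup.of : Bool → BS m)

end BaumslagSolitar

/-! Both groups act on a normed ring `V` by maps `v ↦ pos g + lam ^ e * v`, where `e` is the
exponent sum of `t` in `g` and `lam` is expanding; `V` is `ℝ` for `BS(1, m)`, and for `Γ_M` it is `ℂ
^ d` in eigencoordinates with the sup norm. Diagonalisability makes `M` a coordinatewise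
multiplication, and the eigenvalue condition then says `‖lam⁻¹‖ < 1`. An element is determined by
the pair `(pos g, e)`.

A word of length `n` has `|e| ≤ n`, `‖pos g‖ ≤ Λ ^ n`, and `lam ^ n * pos g` in the lattice.
Conversely, expanding a lattice point in base `lam` shows that a translation of norm at most `β ^ k`
has length `O(k)`. So logarithmic control of norms gives linear control of lengths.

Let `w u = v w`. If `u` has exponent zero, then `pos v = lam ^ r * pos u` and `t ^ r` conjugates. A
nonzero `pos u` is at least exponentially small in `n`, since `lam ^ n` carries it to a nonzero
lattice point, so `r = O(n + 1)`. If `u` has exponent `q > 0`, powers of `u` reduce the exponent of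
`w` below `q`; the conjugacy equation then bounds both the norm of `pos w` and the power of `lam`
clearing its denominators. Negative exponents follow by inversion. -/

/-- `g` is represented by a word of length at most `n` in the letters `S ∪ S⁻¹`. -/
def HasWord {G : Type*} [Group G] (S : Set G) (g : G) (n : ℕ) : Prop :=
  ∃ l : List G, (∀ x ∈ l, x ∈ S ∨ x⁻¹ ∈ S) ∧ l.prod = g ∧ l.length ≤ n

/-! ### Words and word length -/

section Words

variable {G : Type*} [Group G] {S : Set G} {g h : G} {m n : ℕ}

theorem wordLength_le_coe_iff : wordLength S g ≤ (n : ℕ∞) ↔ HasWord S g n := by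
  constructor
  · intro H
    by_contra hc
    have : ((n + 1 : ℕ) : ℕ∞) ≤ wordLength S g := by
      refine le_iInf₂ fun l hl => ?_
      have : ¬ l.length ≤ n := fun h => hc ⟨l, hl.1, hl.2, h⟩
      exact_mod_cast Nat.lt_of_not_le this
    have := this.trans H
    norm_cast at this
    omega
  · rintro ⟨l, h1, h2, h3⟩
    exact (iInf₂_le l ⟨h1, h2⟩).trans (by exact_mod_cast h3)

theorem HasWord.mono (H : HasWord S g m) (hmn : m ≤ n) : HasWord S g n := by
  obtain ⟨l, h1, h2, h3⟩ := H
  exact ⟨l, h1, h2, h3.trans hmn⟩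

theorem HasWord.one : HasWord S (1 : G) 0 := ⟨[], by simp⟩

theorem HasWord.of_mem (hg : g ∈ S) : HasWord S g 1 := ⟨[g], by simp [hg]⟩

theorem HasWord.mul (H : HasWord S g m) (H' : HasWord S h n) : HasWord S (g * h) (m + n) := by
  obtain ⟨l, h1, h2, h3⟩ := H
  obtain ⟨l', h1', h2', h3'⟩ := H'
  refine ⟨l ++ l', ?_, by simp [h2, h2'], by simp; omega⟩
  intro x hx
  rcases List.mem_append.1 hx with hx | hx
  exacts [h1 x hx, h1' x hx]

theorem HasWord.inv (H : HasWord S g n) : HasWord S g⁻¹ n := by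
  obtain ⟨l, h1, h2, h3⟩ := H
  refine ⟨(l.map (·⁻¹)).reverse, ?_, by rw [← h2, List.prod_inv_reverse], by simpa⟩
  intro x hx
  simp only [List.mem_reverse, List.mem_map] at hx
  obtain ⟨y, hy, rfl⟩ := hx
  simpa using (h1 y hy).symm

theorem HasWord.pow (H : HasWord S g 1) : ∀ n : ℕ, HasWord S (g ^ n) n
  | 0 => by simpa using HasWord.one
  | n + 1 => by simpa [pow_succ] using (H.pow n).mul H

theorem HasWord.eq_one (H : HasWord S g 0) : g = 1 := by
  obtain ⟨l, -, h2, h3⟩ := H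
  have : l = [] := List.length_eq_zero_iff.1 (Nat.le_zero.1 h3)
  simpa [this] using h2.symm

theorem exists_hasWord (hS : Subgroup.closure S = ⊤) (g : G) : ∃ n, HasWord S g n := by
  have hg : g ∈ Subgroup.closure S := hS ▸ Subgroup.mem_top g
  induction hg using Subgroup.closure_induction with
  | mem x hx => exact ⟨1, .of_mem hx⟩
  | one => exact ⟨0, .one⟩
  | mul x y _ _ hx hy => exact ⟨_, hx.choose_spec.mul hy.choose_spec⟩
  | inv x _ hx => exact ⟨_, hx.choose_spec.inv⟩

/-- A uniform affine bound on the length of conjugators makes the conjugacy length function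
linearly bounded. -/
theorem conjugacyLengthFunction_le_of_forall {C : ℕ}
    (H : ∀ (n : ℕ) (u v : G), IsConj u v → HasWord S u n → HasWord S v n →
      ∃ w, w * u = v * w ∧ HasWord S w (C * (n + 1))) (n : ℕ) :
    conjugacyLengthFunction S n ≤ ((2 * C * n : ℕ) : ℕ∞) := by
  refine iSup₂_le fun u v => iSup_le fun ⟨huv, hn⟩ => ?_
  have hu : HasWord S u n := wordLength_le_coe_iff.1 (le_self_add.trans hn)
  have hv : HasWord S v n := wordLength_le_coe_iff.1 (le_add_self.trans hn)
  -- At `n = 0` the affine bound is too weak, but both elements are trivial; for `n ≥ 1`, `n + 1 ≤ 2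
  -- * n`.
  obtain rfl | hpos := Nat.eq_zero_or_pos n
  · refine (iInf₂_le 1 (by simp [hu.eq_one, hv.eq_one])).trans ?_
    exact wordLength_le_coe_iff.2 (HasWord.one.mono (Nat.zero_le _))
  · obtain ⟨w, hw, hl⟩ := H n u v huv hu hv
    refine (iInf₂_le w hw).trans (wordLength_le_coe_iff.2 (hl.mono ?_))
    nlinarith

end Words

/-- A group `G` generated by `t` and the image of a finite subset `F` of an abelian group `L`,
where conjugation by `t` acts on the image of `L` as an injective endomorphism `μ`, together with
a linear expanding model: `L` is a discrete subgroup of a normed ring `V`, `μ` is multiplication by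
a unit `lam` with `‖lam⁻¹‖ < 1`, and `G` acts on `V` by affine transformations. -/
structure ExpandingModel (G L V : Type*) [Group G] [AddCommGroup L] [NormedCommRing V] where
  t : G
  α : Multiplicative L →* G
  F : Set L
  F_finite : F.Finite
  closure_eq_top : Subgroup.closure (insert t ((fun x => α (.ofAdd x)) '' F)) = ⊤
  μ : L →+ L
  conj : ∀ x, t * α (.ofAdd x) * t⁻¹ = α (.ofAdd (μ x))
  τ : G →* Multiplicative ℤ
  τ_t : τ t = .ofAdd 1
  τ_α : ∀ x, τ (α x) = 1
  lam : Vˣ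
  ι : L →+ V
  ι_μ : ∀ x, ι (μ x) = lam * ι x
  ρ : G →* Equiv.Perm V
  ρ_t : ∀ v, ρ t v = lam * v
  ρ_α : ∀ x v, ρ (α (.ofAdd x)) v = v + ι x
  norm_inv_lt_one : ‖((lam⁻¹ : Vˣ) : V)‖ < 1
  finite_ball : ∀ R : ℝ, {x | ‖ι x‖ ≤ R}.Finite
  gap : ∃ c > 0, ∀ x, x ≠ 0 → c ≤ ‖ι x‖
  digits : ∃ E, ∀ x, ∃ y, ‖ι (x - μ y)‖ ≤ E

/-! ### Affine coordinates, and necessary conditions on short words -/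

namespace ExpandingModel

variable {G L V : Type*} [Group G] [AddCommGroup L] [NormedCommRing V] (D : ExpandingModel G L V)

/-- The generating set of the model. -/
def gens : Set G := insert D.t ((fun x => D.α (.ofAdd x)) '' D.F)

/-- The translation part of a group element. -/
def pos (g : G) : V := D.ρ g 0

/-- The exponent sum of `t`. -/
def exponent (g : G) : ℤ := (D.τ g).toAdd

theorem exponent_mul (g h : G) : D.exponent (g * h) = D.exponent g + D.exponent h := by
  simp [exponent]

theorem exponent_inv (g : G) : D.exponent g⁻¹ = -D.exponent g := by simp [exponent]

theorem exponent_zpow (g : G) (z : ℤ) : D.exponent (g ^ z) = z * D.exponent g := by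
  simp [exponent]

theorem exponent_t : D.exponent D.t = 1 := by simp [exponent, D.τ_t]

theorem exponent_α (x : L) : D.exponent (D.α (.ofAdd x)) = 0 := by simp [exponent, D.τ_α]

theorem exponent_t_zpow (z : ℤ) : D.exponent (D.t ^ z) = z := by
  simp [exponent_zpow, exponent_t]

theorem exponent_t_pow (n : ℕ) : D.exponent (D.t ^ n) = n := by
  simpa using D.exponent_t_zpow n

theorem ρ_t_inv (v : V) : D.ρ D.t⁻¹ v = ((D.lam⁻¹ : Vˣ) : V) * v := by
  rw [map_inv, Equiv.Perm.inv_eq_iff_eq, D.ρ_t]; simp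

theorem ρ_α_inv (x : L) (v : V) : D.ρ (D.α (.ofAdd x))⁻¹ v = v - D.ι x := by
  rw [map_inv, Equiv.Perm.inv_eq_iff_eq, D.ρ_α]; simp

theorem letter_cases {s : G} (hs : s ∈ D.gens ∨ s⁻¹ ∈ D.gens) :
    s = D.t ∨ s = D.t⁻¹ ∨ (∃ x ∈ D.F, s = D.α (.ofAdd x)) ∨ ∃ x ∈ D.F, s = (D.α (.ofAdd x))⁻¹ := by
  rcases hs with (h | ⟨x, hx, h⟩) | (h | ⟨x, hx, h⟩)
  · exact Or.inl h
  · exact Or.inr (Or.inr (Or.inl ⟨x, hx, h.symm⟩))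
  · exact Or.inr (Or.inl (inv_eq_iff_eq_inv.1 h))
  · exact Or.inr (Or.inr (Or.inr ⟨x, hx, by simp only at h; rw [h, inv_inv]⟩))

/-- Each element acts affinely, with linear part a power of `lam`. -/
theorem ρ_apply (g : G) (v : V) :
    D.ρ g v = D.pos g + ((D.lam ^ D.exponent g : Vˣ) : V) * v := by
  have key : ∀ l : List G, (∀ x ∈ l, x ∈ D.gens ∨ x⁻¹ ∈ D.gens) → ∀ v,
      D.ρ l.prod v = D.ρ l.prod 0 + ((D.lam ^ D.exponent l.prod : Vˣ) : V) * v := by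
    intro l
    induction l with
    | nil => intro _ v; simp [exponent]
    | cons s l ih =>
      intro hl v
      have ih := ih (fun x hx => hl x (List.mem_cons_of_mem _ hx)) v
      rw [List.prod_cons, map_mul, Equiv.Perm.mul_apply, Equiv.Perm.mul_apply, ih, exponent_mul,
        zpow_add]
      rcases D.letter_cases (hl s List.mem_cons_self) with rfl | rfl | ⟨x, -, rfl⟩ | ⟨x, -, rfl⟩
      · rw [D.ρ_t, D.ρ_t, exponent_t]; push_cast; simp; ring
      · rw [ρ_t_inv, ρ_t_inv, exponent_inv, exponent_t]; push_cast; simp; ring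
      · rw [D.ρ_α, D.ρ_α, exponent_α]; simp; ring
      · rw [ρ_α_inv, ρ_α_inv, exponent_inv, exponent_α]; simp; ring
  obtain ⟨n, l, h1, h2, -⟩ := exists_hasWord D.closure_eq_top g
  rw [← h2]
  exact key l h1 v

theorem pos_mul (g h : G) :
    D.pos (g * h) = D.pos g + ((D.lam ^ D.exponent g : Vˣ) : V) * D.pos h := by
  rw [← D.ρ_apply]; simp [pos]

theorem pos_t_zpow (z : ℤ) : D.pos (D.t ^ z) = 0 := by
  have h1 (n : ℕ) : D.pos (D.t ^ n) = 0 := by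
    induction n with
    | zero => simp [pos]
    | succ n ih => rw [pow_succ, pos_mul, ih]; simp [pos, D.ρ_t]
  obtain ⟨n, rfl | rfl⟩ := z.eq_nat_or_neg
  · simpa using h1 n
  · have := D.pos_mul (D.t ^ n) (D.t ^ (-n : ℤ))
    rw [h1, zero_add, zpow_neg, zpow_natCast, mul_inv_cancel] at this
    rw [zpow_neg, zpow_natCast]
    exact ((Units.mul_right_eq_zero _).1 (this.symm.trans (by simp [pos])))

theorem pos_t_pow (n : ℕ) : D.pos (D.t ^ n) = 0 := by simpa using D.pos_t_zpow n

theorem pos_α (x : L) : D.pos (D.α (.ofAdd x)) = D.ι x := by simp [pos, D.ρ_α]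

theorem t_mul_α (x : L) : D.t * D.α (.ofAdd x) = D.α (.ofAdd (D.μ x)) * D.t := by
  rw [← D.conj]; group

theorem t_pow_mul_α (k : ℕ) (x : L) :
    D.t ^ k * D.α (.ofAdd x) = D.α (.ofAdd (D.μ^[k] x)) * D.t ^ k := by
  induction k with
  | zero => simp
  | succ k ih =>
    rw [pow_succ', mul_assoc, ih, ← mul_assoc, t_mul_α, Function.iterate_succ_apply', mul_assoc]

theorem ι_injective : Function.Injective D.ι := by
  obtain ⟨c, hc, h⟩ := D.gap
  refine (injective_iff_map_eq_zero D.ι).2 fun x hx => ?_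
  by_contra hne
  have := h x hne
  rw [hx, norm_zero] at this
  linarith

/-- `t ^ k * g` is a translation followed by a power of `t`. -/
def Clears (k : ℕ) (g : G) : Prop := ∃ (x : L) (j : ℤ), D.t ^ k * g = D.α (.ofAdd x) * D.t ^ j

variable {D}

theorem Clears.succ {k : ℕ} {g : G} (h : D.Clears k g) : D.Clears (k + 1) g := by
  obtain ⟨x, j, h⟩ := h
  refine ⟨D.μ x, j + 1, ?_⟩
  rw [pow_succ', mul_assoc, h, ← mul_assoc, t_mul_α, mul_assoc, ← zpow_one_add, add_comm]

theorem Clears.mono {k m : ℕ} {g : G} (h : D.Clears k g) (hkm : k ≤ m) : D.Clears m g := by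
  induction m, hkm using Nat.le_induction with
  | base => exact h
  | succ m _ ih => exact ih.succ

theorem Clears.exists_eq {k : ℕ} {g : G} (h : D.Clears k g) : ∃ x : L,
    ((D.lam ^ k : Vˣ) : V) * D.pos g = D.ι x ∧
      D.t ^ k * g = D.α (.ofAdd x) * D.t ^ (k + D.exponent g) := by
  obtain ⟨x, j, h⟩ := h
  have h1 := congrArg D.exponent h
  have h2 := congrArg D.pos h
  rw [exponent_mul, exponent_mul, exponent_t_pow, exponent_t_zpow, exponent_α, zero_add] at h1
  rw [pos_mul, pos_mul, pos_t_pow, pos_t_zpow, pos_α, exponent_t_pow, zpow_natCast] at h2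
  refine ⟨x, by simpa using h2, by rw [h1, h]⟩

/-- Only letters `t⁻¹` create denominators, and each is absorbed by one further `t` on the left;
translations pass through powers of `t` by applying `μ`. -/
theorem HasWord.clears {g : G} {n : ℕ} (h : HasWord D.gens g n) : D.Clears n g := by
  have key : ∀ l : List G, (∀ x ∈ l, x ∈ D.gens ∨ x⁻¹ ∈ D.gens) → D.Clears l.length l.prod := by
    intro l
    induction l with
    | nil => intro _; exact ⟨0, 0, by simp⟩
    | cons s l ih =>
      intro hl
      have ih := ih (fun x hx => hl x (List.mem_cons_of_mem _ hx))
      have trans (y : L) : D.Clears (l.length + 1) (D.α (.ofAdd y) * l.prod) := by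
        obtain ⟨x, j, h⟩ := ih.succ
        refine ⟨D.μ^[l.length + 1] y + x, j, ?_⟩
        rw [← mul_assoc, t_pow_mul_α, mul_assoc, h, ← mul_assoc, ofAdd_add, map_mul]
      rw [List.prod_cons, List.length_cons]
      rcases D.letter_cases (hl s List.mem_cons_self) with rfl | rfl | ⟨x, -, rfl⟩ | ⟨x, -, rfl⟩
      · obtain ⟨x, j, h⟩ := ih.succ.succ
        exact ⟨x, j, by rw [← h, ← mul_assoc, ← pow_succ]⟩
      · obtain ⟨x, j, h⟩ := ih
        exact ⟨x, j, by rw [← h, pow_succ, mul_assoc, mul_inv_cancel_left]⟩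
      · exact trans x
      · simpa using trans (-x)
  obtain ⟨l, h1, rfl, h3⟩ := h
  exact (key l h1).mono h3

variable (D)

/-- An element is determined by its translation part and its exponent. -/
theorem eq_of_pos_eq {g h : G} (h1 : D.pos g = D.pos h) (h2 : D.exponent g = D.exponent h) :
    g = h := by
  obtain ⟨m, hm⟩ := exists_hasWord D.closure_eq_top g
  obtain ⟨n, hn⟩ := exists_hasWord D.closure_eq_top h
  -- One power of `t` clears both elements, which reduces the claim to injectivity of `ι`.
  obtain ⟨x, hx, hx'⟩ := ((HasWord.clears hm).mono (le_max_left m n)).exists_eq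
  obtain ⟨y, hy, hy'⟩ := ((HasWord.clears hn).mono (le_max_right m n)).exists_eq
  have : x = y := D.ι_injective (by rw [← hx, ← hy, h1])
  rw [h2, this, ← hy'] at hx'
  exact mul_left_cancel hx'

theorem exists_norm_pos_le : ∃ Λ : ℝ, 1 ≤ Λ ∧ ‖(D.lam : V)‖ ≤ Λ ∧
    ∀ g n, HasWord D.gens g n → ‖D.pos g‖ ≤ Λ ^ n := by
  obtain ⟨B, hB⟩ := (D.F_finite.image fun x => ‖D.ι x‖).bddAbove
  set Λ : ℝ := 1 + ‖(D.lam : V)‖ + max B 0 with hΛ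
  have hB0 : 0 ≤ max B 0 := le_max_right _ _
  have hl0 := norm_nonneg (D.lam : V)
  have hΛ1 : 1 ≤ Λ := by linarith
  refine ⟨Λ, hΛ1, by linarith, ?_⟩
  have step (v : V) (x : L) (hx : x ∈ D.F) : ‖D.ι x‖ ≤ max B 0 :=
    (hB ⟨x, hx, rfl⟩).trans (le_max_left _ _)
  -- The extra `1` makes the bound multiplicative: a letter adding at most `max B 0` to the norm, or
  -- scaling it by `‖lam‖` or less, multiplies `‖v‖ + 1` by at most `Λ`.
  have key : ∀ l : List G, (∀ x ∈ l, x ∈ D.gens ∨ x⁻¹ ∈ D.gens) →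
      ‖D.ρ l.prod 0‖ + 1 ≤ Λ ^ l.length := by
    intro l
    induction l with
    | nil => intro _; simp
    | cons s l ih =>
      intro hl
      have ih := ih (fun x hx => hl x (List.mem_cons_of_mem _ hx))
      rw [List.prod_cons, List.length_cons, map_mul, Equiv.Perm.mul_apply, pow_succ']
      set v := D.ρ l.prod 0
      have hv := norm_nonneg v
      have hb := mul_nonneg hB0 hv
      have hlv := mul_nonneg hl0 hv
      refine le_trans ?_ (mul_le_mul_of_nonneg_left ih (by linarith))
      have hexp : Λ * (‖v‖ + 1) = ‖v‖ + 1 + ‖(D.lam : V)‖ * ‖v‖ + ‖(D.lam : V)‖ +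
          max B 0 * ‖v‖ + max B 0 := by rw [hΛ]; ring
      rw [hexp]
      rcases D.letter_cases (hl s List.mem_cons_self) with rfl | rfl | ⟨x, hx, rfl⟩ | ⟨x, hx, rfl⟩
      · rw [D.ρ_t]
        linarith [norm_mul_le (D.lam : V) v]
      · rw [ρ_t_inv]
        have := norm_mul_le ((D.lam⁻¹ : Vˣ) : V) v
        have := mul_le_mul_of_nonneg_right D.norm_inv_lt_one.le hv
        linarith
      · rw [D.ρ_α]
        linarith [norm_add_le v (D.ι x), step v x hx]
      · rw [ρ_α_inv]
        linarith [norm_sub_le v (D.ι x), step v x hx]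
  rintro g n ⟨l, h1, rfl, h3⟩
  have := key l h1
  have := pow_le_pow_right₀ hΛ1 h3
  unfold pos
  linarith

theorem natAbs_exponent_le {g : G} {n : ℕ} (h : HasWord D.gens g n) :
    (D.exponent g).natAbs ≤ n := by
  have key : ∀ l : List G, (∀ x ∈ l, x ∈ D.gens ∨ x⁻¹ ∈ D.gens) →
      (D.exponent l.prod).natAbs ≤ l.length := by
    intro l
    induction l with
    | nil => intro _; simp [exponent]
    | cons s l ih =>
      intro hl
      have ih := ih (fun x hx => hl x (List.mem_cons_of_mem _ hx))
      rw [List.prod_cons, List.length_cons, exponent_mul]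
      rcases D.letter_cases (hl s List.mem_cons_self) with rfl | rfl | ⟨x, hx, rfl⟩ | ⟨x, hx, rfl⟩
      · rw [exponent_t]; omega
      · rw [exponent_inv, exponent_t]; omega
      · rw [exponent_α]; omega
      · rw [exponent_inv, exponent_α]; omega
  obtain ⟨l, h1, rfl, h3⟩ := h
  exact (key l h1).trans h3

/-! ### Short words for translations -/

theorem hasWord_t : HasWord D.gens D.t 1 := HasWord.of_mem (Set.mem_insert _ _)

/-- Only finitely many lattice points lie in a ball. This supplies words for the digits. -/
theorem exists_hasWord_of_norm_le_const (R : ℝ) :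
    ∃ K : ℕ, ∀ x, ‖D.ι x‖ ≤ R → HasWord D.gens (D.α (.ofAdd x)) K := by
  choose f hf using fun x => exists_hasWord D.closure_eq_top (D.α (.ofAdd x))
  obtain ⟨K, hK⟩ := ((D.finite_ball R).image f).bddAbove
  exact ⟨K, fun x hx => (hf x).mono (hK ⟨x, hx, rfl⟩)⟩

/-- Digit expansion: translations are exponentially distorted. -/
theorem exists_hasWord_of_norm_le : ∃ β > 1, ∃ K : ℕ, ∀ (k : ℕ) (x : L), ‖D.ι x‖ ≤ β ^ k →
    HasWord D.gens (D.α (.ofAdd x)) (K * (k + 1)) := by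
  obtain ⟨E, hE⟩ := D.digits
  obtain ⟨θ, hθ, hθ1⟩ := exists_between (max_lt D.norm_inv_lt_one zero_lt_one)
  have hθ0 : 0 < θ := (le_max_right _ _).trans_lt hθ
  have hθ' : ‖((D.lam⁻¹ : Vˣ) : V)‖ ≤ θ := (le_max_left _ _).trans hθ.le
  obtain ⟨β, hβ1, hβθ⟩ := exists_between ((one_lt_inv₀ hθ0).2 hθ1)
  have hβθ1 : θ * β < 1 := by
    have := mul_lt_mul_of_pos_left hβθ hθ0
    rwa [mul_inv_cancel₀ hθ0.ne'] at this
  have hE0 : 0 ≤ E := (norm_nonneg _).trans (hE 0).choose_spec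
  -- `R` is chosen so that `θ * (R * β ^ (k + 1) + E) ≤ R * β ^ k`, which closes the induction; this
  -- is possible because `θ * β < 1`.
  set R : ℝ := max 1 (θ * E / (1 - θ * β)) with hR
  have hR1 : 1 ≤ R := le_max_left _ _
  have hRE : θ * E ≤ R * (1 - θ * β) :=
    (div_le_iff₀ (by linarith)).1 (le_max_right 1 (θ * E / (1 - θ * β)))
  obtain ⟨K, hK⟩ := D.exists_hasWord_of_norm_le_const (max R E)
  refine ⟨β, hβ1, K + 2, ?_⟩
  have key : ∀ (k : ℕ) (x : L), ‖D.ι x‖ ≤ R * β ^ k →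
      HasWord D.gens (D.α (.ofAdd x)) ((K + 2) * (k + 1)) := by
    intro k
    induction k with
    | zero =>
      intro x hx
      exact (hK x (le_max_of_le_left (by simpa using hx))).mono (by omega)
    | succ k ih =>
      intro x hx
      obtain ⟨y, hy⟩ := hE x
      have hyk : ‖D.ι y‖ ≤ R * β ^ k := by
        have h1 : D.ι y = ((D.lam⁻¹ : Vˣ) : V) * (D.ι x - D.ι (x - D.μ y)) := by
          rw [map_sub, D.ι_μ, sub_sub_cancel, Units.inv_mul_cancel_left]
        have h2 : ‖D.ι y‖ ≤ θ * (R * β ^ (k + 1) + E) := by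
          rw [h1]
          refine (norm_mul_le _ _).trans (mul_le_mul hθ' ?_ (norm_nonneg _) hθ0.le)
          exact (norm_sub_le _ _).trans (add_le_add hx hy)
        have h3 : 1 ≤ β ^ k := one_le_pow₀ hβ1.le
        have h4 : R * (1 - θ * β) * 1 ≤ R * (1 - θ * β) * β ^ k :=
          mul_le_mul_of_nonneg_left h3 (mul_nonneg (by linarith) (by linarith))
        calc ‖D.ι y‖ ≤ θ * (R * β ^ (k + 1) + E) := h2
          _ = θ * E + R * β ^ k * (θ * β) := by ring
          _ ≤ R * (1 - θ * β) * β ^ k + R * β ^ k * (θ * β) := by linarith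
          _ = R * β ^ k := by ring
      have hd := hK _ (hy.trans (le_max_right R E))
      -- Horner step: `x` is a digit plus `μ y`, so each extra digit costs its word and two letters
      -- `t`, `t⁻¹`.
      have hx' : D.α (.ofAdd x) = D.α (.ofAdd (x - D.μ y)) * (D.t * D.α (.ofAdd y) * D.t⁻¹) := by
        rw [D.conj, ← map_mul, ← ofAdd_add, sub_add_cancel]
      rw [hx']
      refine (hd.mul ((D.hasWord_t.mul (ih y hyk)).mul D.hasWord_t.inv)).mono ?_
      ring_nf
      omega
  intro k x hx
  refine key k x (hx.trans ?_)
  have : 0 ≤ β ^ k := by positivity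
  nlinarith

end ExpandingModel

theorem norm_pow_mul_le {R : Type*} [NormedRing R] {a : R} {r : ℝ} (h : ‖a‖ ≤ r) (n : ℕ) (x : R) :
    ‖a ^ n * x‖ ≤ r ^ n * ‖x‖ := by
  have hr : 0 ≤ r := (norm_nonneg a).trans h
  induction n with
  | zero => simp
  | succ n ih =>
    rw [pow_succ', pow_succ', mul_assoc, mul_assoc]
    exact (norm_mul_le _ _).trans (mul_le_mul h ih (norm_nonneg _) hr)

/-! ### Short conjugators -/

namespace ExpandingModel

variable {G L V : Type*} [Group G] [AddCommGroup L] [NormedCommRing V] (D : ExpandingModel G L V)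

theorem exists_contraction : ∃ θ : ℝ, 0 < θ ∧ θ < 1 ∧ ‖((D.lam⁻¹ : Vˣ) : V)‖ ≤ θ := by
  obtain ⟨θ, hθ, hθ1⟩ := exists_between (max_lt D.norm_inv_lt_one zero_lt_one)
  exact ⟨θ, (le_max_right _ _).trans_lt hθ, hθ1, (le_max_left _ _).trans hθ.le⟩

/-- Conjugate translations are conjugate by a power of `t` of linearly bounded exponent. -/
theorem exists_short_conj_of_exponent_eq_zero : ∃ C : ℕ, ∀ (n : ℕ) (u v w : G), w * u = v * w →
    HasWord D.gens u n → HasWord D.gens v n → D.exponent u = 0 → D.exponent v = 0 →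
    0 ≤ D.exponent w → ∃ w, w * u = v * w ∧ HasWord D.gens w (C * (n + 1)) := by
  obtain ⟨Λ, hΛ1, hΛ, hpos⟩ := D.exists_norm_pos_le
  obtain ⟨θ, hθ0, hθ1, hθ⟩ := D.exists_contraction
  obtain ⟨c, hc, hgap⟩ := D.gap
  have hΛ2 : 0 < Λ ^ 2 := by positivity
  -- If `r > (N + N') * (n + 1)`, then `c ≤ Λ ^ (2 * n) * θ ^ r` would force `c ≤ θ ^ N'`,
  -- contradicting the choice of `N'`.
  obtain ⟨N, hN⟩ := exists_pow_lt_of_lt_one (inv_pos.2 hΛ2) hθ1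
  obtain ⟨N', hN'⟩ := exists_pow_lt_of_lt_one hc hθ1
  refine ⟨N + N', fun n u v w huv hu hv hu0 hv0 hw => ?_⟩
  obtain ⟨r, hr⟩ := Int.eq_ofNat_of_zero_le hw
  have hYX : D.pos v = ((D.lam ^ r : Vˣ) : V) * D.pos u := by
    have := congrArg D.pos huv
    rw [pos_mul, pos_mul, hv0, hr, zpow_zero, zpow_natCast] at this
    simp only [Units.val_one, one_mul] at this
    rw [add_comm] at this
    exact (add_right_cancel this).symm
  by_cases hX : D.pos u = 0
  · have h1 : u = 1 := D.eq_of_pos_eq (by rw [hX]; simp [pos]) (by rw [hu0]; simp [exponent])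
    have h2 : v = 1 := D.eq_of_pos_eq (by rw [hYX, hX]; simp [pos]) (by rw [hv0]; simp [exponent])
    exact ⟨1, by simp [h1, h2], HasWord.one.mono (Nat.zero_le _)⟩
  refine ⟨D.t ^ r, D.eq_of_pos_eq ?_ ?_, (D.hasWord_t.pow r).mono ?_⟩
  · rw [pos_mul, pos_mul, hYX, pos_t_pow, exponent_t_pow]; simp
  · rw [exponent_mul, exponent_mul, hu0, hv0, add_comm]
  by_contra! hlt
  obtain ⟨x, hx, -⟩ := (HasWord.clears hu).exists_eq
  have hx0 : x ≠ 0 := by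
    rintro rfl
    rw [map_zero] at hx
    exact hX ((Units.mul_right_eq_zero _).1 hx)
  have h1 : ‖D.ι x‖ ≤ Λ ^ n * ‖D.pos u‖ := by
    rw [← hx, Units.val_pow_eq_pow_val]
    exact norm_pow_mul_le hΛ n _
  have h2 : ‖D.pos u‖ ≤ θ ^ r * Λ ^ n := by
    have : D.pos u = ((D.lam⁻¹ : Vˣ) : V) ^ r * D.pos v := by
      rw [hYX, ← mul_assoc, ← Units.val_pow_eq_pow_val, ← Units.val_mul]; simp
    rw [this]
    exact (norm_pow_mul_le hθ r _).trans
      (mul_le_mul_of_nonneg_left (hpos v n hv) (by positivity))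
  have h3 : θ ^ r ≤ θ ^ (N * n) * θ ^ N' := by
    rw [← pow_add]
    exact pow_le_pow_of_le_one hθ0.le hθ1.le (by nlinarith)
  have h4 : (θ ^ N * Λ ^ 2) ^ n ≤ 1 := by
    refine pow_le_one₀ (by positivity) ?_
    have := mul_le_mul_of_nonneg_right hN.le hΛ2.le
    rwa [inv_mul_cancel₀ hΛ2.ne'] at this
  have h5 : c ≤ θ ^ N' := calc
    c ≤ Λ ^ n * (θ ^ (N * n) * θ ^ N' * Λ ^ n) := by
        refine (hgap x hx0).trans (h1.trans (mul_le_mul_of_nonneg_left (h2.trans ?_)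
          (by positivity)))
        exact mul_le_mul_of_nonneg_right h3 (by positivity)
    _ = (θ ^ N * Λ ^ 2) ^ n * θ ^ N' := by rw [pow_mul]; ring
    _ ≤ 1 * θ ^ N' := mul_le_mul_of_nonneg_right h4 (by positivity)
    _ = θ ^ N' := one_mul _
  linarith

/-- The points of `V` that `lam ^ n` maps into the lattice. -/
def clearable (n : ℕ) : AddSubgroup V :=
  D.ι.range.comap (AddMonoidHom.mulLeft ((D.lam ^ n : Vˣ) : V))

variable {D} in
theorem mem_clearable {n : ℕ} {v : V} :
    v ∈ D.clearable n ↔ ∃ x, D.ι x = ((D.lam ^ n : Vˣ) : V) * v := Iff.rfl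

variable {D} in
theorem pow_mul_mem_clearable {n : ℕ} {v : V} (h : v ∈ D.clearable n) (k : ℕ) :
    ((D.lam ^ k : Vˣ) : V) * v ∈ D.clearable n := by
  induction k with
  | zero => simpa
  | succ k ih =>
    obtain ⟨x, hx⟩ := mem_clearable.1 ih
    refine mem_clearable.2 ⟨D.μ x, ?_⟩
    rw [D.ι_μ, hx]; push_cast; ring

variable {D} in
theorem ι_mem_clearable (n : ℕ) (x : L) : D.ι x ∈ D.clearable n := by
  refine mem_clearable.2 ⟨D.μ^[n] x, ?_⟩
  induction n with
  | zero => simp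
  | succ n ih => rw [Function.iterate_succ_apply', D.ι_μ, ih]; push_cast; ring

variable {D} in
theorem HasWord.pos_mem_clearable {g : G} {n : ℕ} (h : HasWord D.gens g n) :
    D.pos g ∈ D.clearable n := by
  obtain ⟨x, hx, -⟩ := (HasWord.clears h).exists_eq
  exact ⟨x, hx.symm⟩

/-- With `X`, `Y`, `Z` the translation parts of `u`, `v`, `w`, conjugacy reads `Z + lam ^ r * X = Y
+ lam ^ q * Z`. Read in one direction it removes denominators of `Z`; in the other, `lam ^ q` being
expanding, it bounds `‖Z‖`. -/
theorem exists_short_conj_of_exponent_pos : ∃ C : ℕ, ∀ (n : ℕ) (u v w : G), w * u = v * w →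
    HasWord D.gens u n → HasWord D.gens v n → 0 < D.exponent u → D.exponent v = D.exponent u →
    ∃ w, w * u = v * w ∧ HasWord D.gens w (C * (n + 1)) := by
  obtain ⟨Λ, hΛ1, hΛ, hpos⟩ := D.exists_norm_pos_le
  obtain ⟨θ, hθ0, hθ1, hθ⟩ := D.exists_contraction
  obtain ⟨β, hβ, K, hK⟩ := D.exists_hasWord_of_norm_le
  -- The cube is `Λ ^ n` for clearing denominators times `Λ ^ (2 * n)` from the bound on `‖Z‖`.
  obtain ⟨N, hN⟩ := pow_unbounded_of_one_lt (Λ ^ 3) hβ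
  obtain ⟨N', hN'⟩ := pow_unbounded_of_one_lt (2 / (1 - θ)) hβ
  refine ⟨3 + K * (N + N' + 1), fun n u v w₀ huv hu hv hu0 hvu => ?_⟩
  set p := D.exponent u with hp
  -- Right multiplication by a power of `u` keeps `w` a conjugator, so its exponent may be reduced
  -- modulo `p`.
  obtain ⟨w, hw, hw0, hwp⟩ : ∃ w, w * u = v * w ∧ 0 ≤ D.exponent w ∧ D.exponent w < p := by
    refine ⟨w₀ * u ^ (-(D.exponent w₀ / p)), ?_, ?_⟩
    · rw [mul_assoc, ← mul_assoc v, ← huv, mul_assoc, (Commute.zpow_self u _).eq]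
    · have : D.exponent (w₀ * u ^ (-(D.exponent w₀ / p))) = D.exponent w₀ % p := by
        rw [exponent_mul, exponent_zpow, ← hp, Int.emod_def]; ring
      rw [this]
      exact ⟨Int.emod_nonneg _ hu0.ne', Int.emod_lt_of_pos _ hu0⟩
  refine ⟨w, hw, ?_⟩
  have hpn : p.natAbs ≤ n := D.natAbs_exponent_le hu
  obtain ⟨r, hr⟩ := Int.eq_ofNat_of_zero_le hw0
  obtain ⟨q, hq⟩ := Int.eq_ofNat_of_zero_le hu0.le
  have hrn : r ≤ n := by omega
  have hqpos : 0 < q := by omega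
  set X := D.pos u
  set Y := D.pos v
  set Z := D.pos w with hZ
  have heq : Z + ((D.lam ^ r : Vˣ) : V) * X = Y + ((D.lam ^ q : Vˣ) : V) * Z := by
    have := congrArg D.pos hw
    rwa [pos_mul, pos_mul, hvu, hr, hq, zpow_natCast, zpow_natCast] at this
  have hX : X ∈ D.clearable n := HasWord.pos_mem_clearable hu
  have hY : Y ∈ D.clearable n := HasWord.pos_mem_clearable hv
  have hZmem : Z ∈ D.clearable n := by
    -- Since `lam ^ k * Z = lam ^ k * (Y - lam ^ r * X) + lam ^ (k + q) * Z` with `q ≥ 1`,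
    -- clearability passes from `k + 1` down to `k`.
    have descend : ∀ k : ℕ, ((D.lam ^ k : Vˣ) : V) * Z ∈ D.clearable n → Z ∈ D.clearable n := by
      intro k
      induction k with
      | zero => simp
      | succ k ih =>
        intro hk
        refine ih ?_
        obtain ⟨s, rfl⟩ : ∃ s, q = s + 1 := ⟨q - 1, by omega⟩
        have : ((D.lam ^ k : Vˣ) : V) * Z =
            ((D.lam ^ k : Vˣ) : V) * (Y - ((D.lam ^ r : Vˣ) : V) * X) +
              ((D.lam ^ s : Vˣ) : V) * (((D.lam ^ (k + 1) : Vˣ) : V) * Z) := by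
          push_cast at heq ⊢
          linear_combination ((D.lam : V) ^ k) * heq
        rw [this]
        exact add_mem (pow_mul_mem_clearable (sub_mem hY (pow_mul_mem_clearable hX r)) k)
          (pow_mul_mem_clearable hk s)
    obtain ⟨m, hm⟩ := exists_hasWord D.closure_eq_top w
    obtain ⟨z, hz, -⟩ := (HasWord.clears hm).exists_eq
    exact descend m (hz ▸ ι_mem_clearable n z)
  obtain ⟨z, hz⟩ := mem_clearable.1 hZmem
  have hZle : ‖Z‖ * (1 - θ) ≤ 2 * Λ ^ (2 * n) := by
    have h1 : Z = ((D.lam⁻¹ : Vˣ) : V) ^ q * (Z + ((D.lam ^ r : Vˣ) : V) * X - Y) := by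
      rw [heq, add_sub_cancel_left, ← mul_assoc, ← Units.val_pow_eq_pow_val, ← Units.val_mul]
      simp
    have h2 : ‖((D.lam ^ r : Vˣ) : V) * X‖ ≤ Λ ^ (2 * n) := by
      rw [Units.val_pow_eq_pow_val, two_mul, pow_add]
      exact (norm_pow_mul_le hΛ r X).trans (mul_le_mul (pow_le_pow_right₀ hΛ1 hrn) (hpos u n hu)
        (norm_nonneg _) (by positivity))
    have h3 : ‖Y‖ ≤ Λ ^ (2 * n) := (hpos v n hv).trans (pow_le_pow_right₀ hΛ1 (by omega))
    have h4 := norm_pow_mul_le hθ q (Z + ((D.lam ^ r : Vˣ) : V) * X - Y)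
    rw [← h1] at h4
    have h5 : ‖Z + ((D.lam ^ r : Vˣ) : V) * X - Y‖ ≤ ‖Z‖ + 2 * Λ ^ (2 * n) := by
      linarith [norm_sub_le (Z + ((D.lam ^ r : Vˣ) : V) * X) Y,
        norm_add_le Z (((D.lam ^ r : Vˣ) : V) * X)]
    have h6 : θ ^ q ≤ θ := pow_le_of_le_one hθ0.le hθ1.le hqpos.ne'
    have h7 : ‖Z‖ ≤ θ * (‖Z‖ + 2 * Λ ^ (2 * n)) :=
      h4.trans (mul_le_mul h6 h5 (norm_nonneg _) hθ0.le)
    have h8 : 0 ≤ (1 - θ) * (2 * Λ ^ (2 * n)) := mul_nonneg (by linarith) (by positivity)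
    linarith
  have hzle : ‖D.ι z‖ ≤ β ^ (N * n + N') := by
    have h1 : ‖D.ι z‖ ≤ Λ ^ n * ‖Z‖ := by
      rw [hz, Units.val_pow_eq_pow_val]
      exact norm_pow_mul_le hΛ n Z
    have h2 : ‖Z‖ ≤ 2 / (1 - θ) * Λ ^ (2 * n) := by
      rw [div_mul_eq_mul_div]
      exact (le_div_iff₀ (by linarith)).2 hZle
    calc ‖D.ι z‖ ≤ Λ ^ n * (2 / (1 - θ) * Λ ^ (2 * n)) :=
          h1.trans (mul_le_mul_of_nonneg_left h2 (by positivity))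
      _ = (Λ ^ 3) ^ n * (2 / (1 - θ)) := by ring
      _ ≤ (β ^ N) ^ n * β ^ N' := mul_le_mul (pow_le_pow_left₀ (by positivity) hN.le n) hN'.le
          (div_nonneg zero_le_two (by linarith)) (by positivity)
      _ = β ^ (N * n + N') := by rw [pow_add, pow_mul]
  have hwz : w = (D.t ^ n)⁻¹ * (D.α (.ofAdd z) * D.t ^ (n + r)) := by
    rw [eq_inv_mul_iff_mul_eq]
    refine D.eq_of_pos_eq ?_ ?_
    · rw [pos_mul, pos_mul, pos_α, pos_t_pow, pos_t_pow, exponent_t_pow, zpow_natCast, hz]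
      simp [hZ]
    · rw [exponent_mul, exponent_mul, exponent_α, exponent_t_pow, exponent_t_pow, hr]
      simp
  rw [hwz]
  refine ((D.hasWord_t.pow n).inv.mul ((hK _ z hzle).mul (D.hasWord_t.pow (n + r)))).mono ?_
  have h1 : K * (N * n + N' + 1) ≤ K * (N + N' + 1) * (n + 1) := by
    rw [mul_assoc]
    exact Nat.mul_le_mul_left K (by nlinarith)
  linarith

theorem conjugacyLengthFunction_linear :
    ∃ C : ℕ, ∀ n, conjugacyLengthFunction D.gens n ≤ ((C * n : ℕ) : ℕ∞) := by
  obtain ⟨C₁, h₁⟩ := D.exists_short_conj_of_exponent_eq_zero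
  obtain ⟨C₂, h₂⟩ := D.exists_short_conj_of_exponent_pos
  refine ⟨2 * (C₁ + C₂), conjugacyLengthFunction_le_of_forall fun n u v huv hu hv => ?_⟩
  have le₁ : C₁ * (n + 1) ≤ (C₁ + C₂) * (n + 1) := Nat.mul_le_mul_right _ (by omega)
  have le₂ : C₂ * (n + 1) ≤ (C₁ + C₂) * (n + 1) := Nat.mul_le_mul_right _ (by omega)
  obtain ⟨w, hw⟩ := isConj_iff.1 huv
  have hw : w * u = v * w := by rw [← hw]; group
  have hexp : D.exponent v = D.exponent u := by
    have := congrArg D.exponent hw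
    rw [exponent_mul, exponent_mul] at this
    linarith
  rcases lt_trichotomy (D.exponent u) 0 with h | h | h
  -- The same elements conjugate `u⁻¹` to `v⁻¹`, and these have positive exponent.
  · obtain ⟨w', hw', hl⟩ := h₂ n u⁻¹ v⁻¹ w
      (by rw [mul_inv_eq_iff_eq_mul, mul_assoc, hw, inv_mul_cancel_left]) hu.inv hv.inv
      (by rw [exponent_inv]; omega) (by rw [exponent_inv, exponent_inv, hexp])
    refine ⟨w', ?_, hl.mono le₂⟩
    rw [mul_inv_eq_iff_eq_mul, mul_assoc, eq_inv_mul_iff_mul_eq] at hw'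
    exact hw'.symm
  · rcases le_total 0 (D.exponent w) with h0 | h0
    · obtain ⟨w', hw', hl⟩ := h₁ n u v w hw hu hv h (hexp.trans h) h0
      exact ⟨w', hw', hl.mono le₁⟩
    · obtain ⟨w', hw', hl⟩ := h₁ n v u w⁻¹
        (by rw [inv_mul_eq_iff_eq_mul, ← mul_assoc, hw, mul_inv_cancel_right]) hv hu
        (hexp.trans h) h (by rw [exponent_inv]; omega)
      refine ⟨w'⁻¹, ?_, hl.inv.mono le₁⟩
      rw [inv_mul_eq_iff_eq_mul, ← mul_assoc, hw', mul_inv_cancel_right]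
  · obtain ⟨w', hw', hl⟩ := h₂ n u v w hw hu hv h hexp
    exact ⟨w', hw', hl.mono le₂⟩

end ExpandingModel

/-! ### Homomorphisms out of `ℤ ^ d` -/

section FreeAbelian

variable {H : Type*} [Group H] {d : ℕ}

theorem MonoidHom.prod_ofFn_zpow (β : Multiplicative (Fin d → ℤ) →* H) (x : Fin d → ℤ) :
    (List.ofFn fun j => β (.ofAdd (Pi.single j 1)) ^ x j).prod = β (.ofAdd x) := by
  have h1 : (List.ofFn fun j => β (.ofAdd (Pi.single j 1)) ^ x j) =
      (List.ofFn fun j : Fin d =>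
        (Multiplicative.ofAdd (Pi.single j 1 : Fin d → ℤ)) ^ x j).map β := by
    simp [List.map_ofFn, Function.comp_def]
  rw [h1, ← map_list_prod, List.prod_ofFn]
  congr 1
  apply Multiplicative.toAdd.injective
  rw [toAdd_prod]
  simp only [toAdd_zpow, toAdd_ofAdd]
  ext i
  simp [Finset.sum_apply, Pi.single_apply]

theorem MonoidHom.ext_single {β γ : Multiplicative (Fin d → ℤ) →* H}
    (h : ∀ j, β (.ofAdd (Pi.single j 1)) = γ (.ofAdd (Pi.single j 1))) : β = γ := by
  refine MonoidHom.ext fun x => ?_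
  have h1 := β.prod_ofFn_zpow x.toAdd
  simp only [h, γ.prod_ofFn_zpow x.toAdd] at h1
  exact h1.symm

theorem pairwise_commute_zpowersHom (b : Fin d → H) (hb : ∀ i j, Commute (b i) (b j)) :
    Pairwise fun i j => ∀ x y : Multiplicative ℤ,
      Commute (zpowersHom H (b i) x) (zpowersHom H (b j) y) := fun i j _ x y => by
  simpa [zpowersHom_apply] using (hb i j).zpow_zpow _ _

/-- The homomorphism from `ℤ ^ d` determined by commuting elements. -/
noncomputable def homOfCommute (b : Fin d → H) (hb : ∀ i j, Commute (b i) (b j)) :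
    Multiplicative (Fin d → ℤ) →* H :=
  (MonoidHom.noncommPiCoprod (fun i => zpowersHom H (b i)) (pairwise_commute_zpowersHom b hb)).comp
    (MulEquiv.piMultiplicative fun _ : Fin d => ℤ).toMonoidHom

theorem homOfCommute_single (b : Fin d → H) (hb : ∀ i j, Commute (b i) (b j)) (i : Fin d) :
    homOfCommute b hb (.ofAdd (Pi.single i 1)) = b i := by
  have : (MulEquiv.piMultiplicative fun _ : Fin d => ℤ) (.ofAdd (Pi.single i 1)) =
      Pi.mulSingle i (Multiplicative.ofAdd 1) := by
    ext j
    rcases eq_or_ne j i with rfl | h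
    · simp [MulEquiv.piMultiplicative]
    · simp [MulEquiv.piMultiplicative, h]
  rw [homOfCommute, MonoidHom.comp_apply, MulEquiv.toMonoidHom_eq_coe, MonoidHom.coe_coe, this,
    MonoidHom.noncommPiCoprod_mulSingle]
  simp [zpowersHom_apply]

end FreeAbelian

/-- The translations of an additive group, as permutations. -/
def translation (V : Type*) [AddCommGroup V] : Multiplicative V →* Equiv.Perm V where
  toFun v := Equiv.addRight v.toAdd
  map_one' := by ext; simp
  map_mul' v w := by ext x; simp [add_comm, add_left_comm]

theorem translation_apply {V : Type*} [AddCommGroup V] (v w : V) :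
    translation V (.ofAdd v) w = w + v := rfl

/-! ### The model of `BS(1, m)` -/

namespace BaumslagSolitar

variable (m : ℤ)

theorem relation : (PresentedGroup.of true : BS m) * PresentedGroup.of false *
    (PresentedGroup.of true)⁻¹ = PresentedGroup.of false ^ m := by
  have : PresentedGroup.mk (relators m) (FreeGroup.of true * FreeGroup.of false *
      (FreeGroup.of true)⁻¹ * (FreeGroup.of false ^ m)⁻¹) = 1 :=
    PresentedGroup.one_of_mem rfl
  simp only [map_mul, map_inv, map_zpow, mul_inv_eq_one] at this
  exact this

/-- The exponent sum of `t`. -/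
def exponentHom : BS m →* Multiplicative ℤ :=
  PresentedGroup.toGroup (f := fun b => if b then .ofAdd 1 else 1) (by
    rintro r rfl
    simp)

variable {m}

/-- The affine action on the real line. -/
noncomputable def affineHom (hm : (m : ℝ) ≠ 0) : BS m →* Equiv.Perm ℝ :=
  PresentedGroup.toGroup
    (f := fun b => if b then (Units.mk0 (m : ℝ) hm).mulLeft else translation ℝ (.ofAdd 1)) (by
    rintro r rfl
    simp only [map_mul, map_inv, map_zpow, FreeGroup.lift_apply_of, if_true,
      mul_inv_eq_iff_eq_mul]
    rw [if_neg (by simp), ← map_zpow, ← ofAdd_zsmul]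
    ext x
    simp [translation_apply, mul_add])

/-- The expanding model of `BS(1, m)`. -/
noncomputable def model (hm : 1 < |m|) : ExpandingModel (BS m) ℤ ℝ :=
  have hm' : 1 < |(m : ℝ)| := by exact_mod_cast hm
  have hm0 : (m : ℝ) ≠ 0 := abs_pos.1 (by linarith)
  { t := PresentedGroup.of true
    α := zpowersHom _ (PresentedGroup.of false)
    F := {1}
    F_finite := Set.finite_singleton _
    closure_eq_top := by
      rw [← PresentedGroup.closure_range_of (relators m)]
      congr 1
      ext g
      simp [zpowersHom_apply, or_comm]
    μ := AddMonoidHom.mulLeft m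
    conj := fun x => by
      simp only [zpowersHom_apply, toAdd_ofAdd, AddMonoidHom.coe_mulLeft]
      rw [← conj_zpow, relation, zpow_mul]
    τ := exponentHom m
    τ_t := by simp [exponentHom]
    τ_α := fun x => by simp [exponentHom, zpowersHom_apply]
    lam := Units.mk0 m hm0
    ι := Int.castAddHom ℝ
    ι_μ := fun x => by simp
    ρ := affineHom hm0
    ρ_t := fun v => by simp [affineHom]
    ρ_α := fun x v => by
      simp only [zpowersHom_apply, toAdd_ofAdd, map_zpow]
      simp only [affineHom, PresentedGroup.toGroup.of, Bool.false_eq_true, if_false]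
      rw [← map_zpow, ← ofAdd_zsmul, translation_apply]
      simp
    norm_inv_lt_one := by
      rw [Units.val_inv_eq_inv_val, norm_inv]
      exact inv_lt_one_of_one_lt₀ hm'
    finite_ball := fun R => by
      refine (isCompact_closedBall (0 : ℤ) R).finite_of_discrete.subset fun x hx => ?_
      rw [mem_closedBall_zero_iff]
      simpa [Int.norm_eq_abs] using hx
    gap := ⟨1, one_pos, fun x hx => by simpa using (by exact_mod_cast Int.one_le_abs hx)⟩
    digits := ⟨|m|, fun x => ⟨x / m, by
      have h1 : x - m * (x / m) = x % m := (Int.emod_def x m).symm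
      have h2 : |x % m| ≤ |m| := by
        rw [abs_of_nonneg (Int.emod_nonneg _ (by rintro rfl; simp at hm))]
        exact (Int.emod_lt_abs _ (by rintro rfl; simp at hm)).le
      simp only [AddMonoidHom.coe_mulLeft, h1, Int.coe_castAddHom, Real.norm_eq_abs]
      exact_mod_cast h2⟩⟩ }

theorem model_gens (hm : 1 < |m|) : (model hm).gens = generators m := by
  ext g
  simp [ExpandingModel.gens, model, generators, zpowersHom_apply, or_comm]

end BaumslagSolitar

/-! ### The model of `Γ_M` in eigencoordinates -/

namespace AbByCyclic

open Matrix

variable {d : ℕ} (M : Matrix (Fin d) (Fin d) ℤ)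

/-- Turns the word `φ_M(a_i)` into the image of the `i`-th column of `M`, so that relators can be
checked by linear algebra. -/
theorem phi_image {H : Type*} [Group H] (f : FreeGroup (Letter d) →* H)
    (β : Multiplicative (Fin d → ℤ) →* H) (h : ∀ j, f (a j) = β (.ofAdd (Pi.single j 1)))
    (i : Fin d) : f (phi M i) = β (.ofAdd (M *ᵥ Pi.single i 1)) := by
  rw [← β.prod_ofFn_zpow, phi, map_list_prod, List.map_ofFn]
  congr 2
  ext j
  simp [h, Matrix.col]

theorem commute_of (i j : Fin d) :
    Commute (PresentedGroup.of (some i) : Gam M) (PresentedGroup.of (some j)) := by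
  have : PresentedGroup.mk (relators M) (a i * a j * (a i)⁻¹ * (a j)⁻¹) = 1 :=
    PresentedGroup.one_of_mem (Or.inl ⟨i, j, rfl⟩)
  simp only [map_mul, map_inv, mul_inv_eq_iff_eq_mul, one_mul] at this
  exact this

/-- The inclusion of the base group. -/
noncomputable def base : Multiplicative (Fin d → ℤ) →* Gam M :=
  homOfCommute (fun i => PresentedGroup.of (some i)) (commute_of M)

theorem base_single (i : Fin d) : base M (.ofAdd (Pi.single i 1)) = PresentedGroup.of (some i) :=
  homOfCommute_single _ _ i

/-- Both sides are homomorphisms in `x`, and on basis vectors the identity is a defining relation.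
-/
theorem conj_base (x : Fin d → ℤ) :
    (PresentedGroup.of none : Gam M) * base M (.ofAdd x) * (PresentedGroup.of none)⁻¹ =
      base M (.ofAdd (M *ᵥ x)) := by
  have : (MulAut.conj (PresentedGroup.of none : Gam M)).toMonoidHom.comp (base M) =
      (base M).comp (AddMonoidHom.toMultiplicative M.mulVecLin.toAddMonoidHom) := by
    refine MonoidHom.ext_single fun i => ?_
    have h : PresentedGroup.mk (relators M) (t d * a i * (t d)⁻¹ * (phi M i)⁻¹) = 1 :=
      PresentedGroup.one_of_mem (Or.inr ⟨i, rfl⟩)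
    rw [map_mul, map_inv _ (phi M i), mul_inv_eq_one,
      phi_image M _ (base M) (fun j => (base_single M j).symm) i] at h
    simp only [map_mul, map_inv] at h
    rw [MonoidHom.comp_apply, base_single]
    exact h
  have h := DFunLike.congr_fun this (Multiplicative.ofAdd x)
  rw [MonoidHom.comp_apply, MonoidHom.comp_apply, MulEquiv.toMonoidHom_eq_coe,
    MonoidHom.coe_coe, MulAut.conj_apply] at h
  exact h

/-- The exponent sum of `t`. -/
def exponentHom : Gam M →* Multiplicative ℤ :=
  PresentedGroup.toGroup (f := fun l => l.elim (.ofAdd 1) fun _ => 1) (by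
    rintro r (⟨i, j, rfl⟩ | ⟨i, rfl⟩)
    · simp [a]
    · rw [map_mul, map_inv _ (phi M i), phi_image M _ 1 (fun j => by simp [a])]
      simp [a, t])

variable {M} {P : Matrix (Fin d) (Fin d) ℂ} {D : Fin d → ℂ}

/-- Eigencoordinates on the lattice. -/
noncomputable def coordinates (P : Matrix (Fin d) (Fin d) ℂ) : (Fin d → ℤ) →+ (Fin d → ℂ) :=
  (P⁻¹).mulVecLin.toAddMonoidHom.comp ((Int.castAddHom ℂ).compLeft (Fin d))

theorem coordinates_apply (x : Fin d → ℤ) :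
    coordinates P x = P⁻¹ *ᵥ fun i => (x i : ℂ) := rfl

theorem coordinates_mulVec (hP : IsUnit P)
    (h : M.map (Int.cast : ℤ → ℂ) * P = P * Matrix.diagonal D) (x : Fin d → ℤ) :
    coordinates P (M *ᵥ x) = D * coordinates P x := by
  have hdet : IsUnit P.det := (Matrix.isUnit_iff_isUnit_det P).1 hP
  have h1 : P⁻¹ * M.map (Int.cast : ℤ → ℂ) = Matrix.diagonal D * P⁻¹ := by
    rw [← Matrix.mul_one (P⁻¹ * _), ← Matrix.mul_nonsing_inv P hdet, Matrix.mul_assoc,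
      ← Matrix.mul_assoc _ P, h, Matrix.mul_assoc, Matrix.nonsing_inv_mul_cancel_left _ _ hdet]
  have h2 : (fun i => ((M *ᵥ x) i : ℂ)) = M.map (Int.cast : ℤ → ℂ) *ᵥ fun i => (x i : ℂ) := by
    ext i
    exact RingHom.map_mulVec (Int.castRingHom ℂ) M x i
  rw [coordinates_apply, coordinates_apply, h2, Matrix.mulVec_mulVec, h1, ← Matrix.mulVec_mulVec]
  ext i
  simp [Matrix.mulVec_diagonal]

theorem exists_norm_le_coordinates (hP : IsUnit P) :
    ∃ K > 0, ∀ x : Fin d → ℤ, ‖x‖ ≤ K * ‖coordinates P x‖ := by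
  have hdet : IsUnit P.det := (Matrix.isUnit_iff_isUnit_det P).1 hP
  -- The maximum with `1` keeps the constant positive when the operator norm vanishes, as for `d =
  -- 0`.
  refine ⟨max 1 ‖P.mulVecLin.toContinuousLinearMap‖, by positivity, fun x => ?_⟩
  have h1 : P *ᵥ coordinates P x = fun i => (x i : ℂ) := by
    rw [coordinates_apply, Matrix.mulVec_mulVec, Matrix.mul_nonsing_inv _ hdet, Matrix.one_mulVec]
  have h2 : ‖x‖ = ‖fun i => (x i : ℂ)‖ := by
    simp only [Pi.norm_def]
    congr 2
    ext i
    simp [Int.norm_eq_abs]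
  rw [h2, ← h1]
  refine (P.mulVecLin.toContinuousLinearMap.le_opNorm (coordinates P x)).trans ?_
  exact mul_le_mul_of_nonneg_right (le_max_right _ _) (norm_nonneg _)

/-- Divide `adj(M) x` by `det M` coordinatewise, with quotient `y` and remainder `r`. Then `M r =
det M • (x - M y)`, and `r` ranges over a finite box. -/
theorem exists_digit_bound (hM : M.det ≠ 0) : ∃ E, ∀ x : Fin d → ℤ, ∃ y : Fin d → ℤ,
    ‖coordinates P (x - M *ᵥ y)‖ ≤ E := by
  obtain ⟨E, hE⟩ := ((Set.finite_Icc (0 : Fin d → ℤ) (fun _ => |M.det|)).image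
    fun r => ‖coordinates P (M *ᵥ r)‖).bddAbove
  refine ⟨E, fun x => ⟨fun i => (M.adjugate *ᵥ x) i / M.det, ?_⟩⟩
  set y : Fin d → ℤ := fun i => (M.adjugate *ᵥ x) i / M.det with hy
  set r : Fin d → ℤ := fun i => (M.adjugate *ᵥ x) i % M.det
  have hr : r = M.adjugate *ᵥ x - M.det • y := by
    ext i
    simp [r, y, Int.emod_def]
  have hMr : M *ᵥ r = M.det • (x - M *ᵥ y) := by
    rw [hr, Matrix.mulVec_sub, Matrix.mulVec_mulVec, Matrix.mul_adjugate, Matrix.mulVec_smul,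
      Matrix.smul_mulVec, Matrix.one_mulVec, smul_sub]
  have hle : ‖coordinates P (M *ᵥ r)‖ ≤ E := hE ⟨r, ⟨fun i => Int.emod_nonneg _ hM,
    fun i => (Int.emod_lt_abs _ hM).le⟩, rfl⟩
  rw [hMr, map_zsmul, ← Int.cast_smul_eq_zsmul ℂ, norm_smul] at hle
  refine le_trans ?_ hle
  have : (1 : ℝ) ≤ ‖(M.det : ℂ)‖ := by
    rw [Complex.norm_intCast]
    exact_mod_cast Int.one_le_abs hM
  exact le_mul_of_one_le_left (norm_nonneg _) this

/-- The affine action in eigencoordinates. -/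
noncomputable def affineHom (lam : (Fin d → ℂ)ˣ)
    (hlam : ∀ x, coordinates P (M *ᵥ x) = lam * coordinates P x) :
    Gam M →* Equiv.Perm (Fin d → ℂ) :=
  PresentedGroup.toGroup (f := fun l => l.elim lam.mulLeft
    fun i => translation _ (.ofAdd (coordinates P (Pi.single i 1)))) (by
    rintro r (⟨i, j, rfl⟩ | ⟨i, rfl⟩)
    · simp only [a, map_mul, map_inv, FreeGroup.lift_apply_of,
        mul_inv_eq_iff_eq_mul, one_mul, Option.elim_some]
      exact ((Commute.all _ _).map (translation (Fin d → ℂ))).eq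
    · rw [map_mul, map_inv _ (phi M i), phi_image M _
        ((translation (Fin d → ℂ)).comp (AddMonoidHom.toMultiplicative (coordinates P)))
        (fun j => by simp [a])]
      simp only [a, t, map_mul, map_inv, FreeGroup.lift_apply_of,
        mul_inv_eq_iff_eq_mul, one_mul, Option.elim_some, Option.elim_none]
      ext1 v
      simpa [translation_apply, mul_add] using (hlam (Pi.single i 1)).symm)

/-- The expanding model of `Γ_M`. -/
noncomputable def model (hP : IsUnit P)
    (h : M.map (Int.cast : ℤ → ℂ) * P = P * Matrix.diagonal D) (hM : M.det ≠ 0)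
    (hD : ∀ i, 1 < ‖D i‖) : ExpandingModel (Gam M) (Fin d → ℤ) (Fin d → ℂ) :=
  have hD0 (i : Fin d) : D i ≠ 0 := norm_pos_iff.1 (one_pos.trans (hD i))
  let lam : (Fin d → ℂ)ˣ := ⟨D, D⁻¹, by ext i; simp [hD0], by ext i; simp [hD0]⟩
  { t := PresentedGroup.of none
    α := base M
    F := Set.range fun i => Pi.single i 1
    F_finite := Set.finite_range _
    closure_eq_top := by
      rw [← PresentedGroup.closure_range_of (relators M)]
      congr 1
      ext g
      simp [base_single, Option.exists, eq_comm]
    μ := M.mulVecLin.toAddMonoidHom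
    conj := conj_base M
    τ := exponentHom M
    τ_t := by simp [exponentHom]
    τ_α := fun x => by
      have : (exponentHom M).comp (base M) = 1 :=
        MonoidHom.ext_single fun i => by simp [base_single, exponentHom]
      exact DFunLike.congr_fun this x
    lam := lam
    ι := coordinates P
    ι_μ := coordinates_mulVec hP h
    ρ := affineHom lam (coordinates_mulVec hP h)
    ρ_t := fun v => by simp [affineHom]
    ρ_α := fun x v => by
      have : (affineHom lam (coordinates_mulVec hP h)).comp (base M) =
          (translation (Fin d → ℂ)).comp (AddMonoidHom.toMultiplicative (coordinates P)) :=
        MonoidHom.ext_single fun i => by simp [base_single, affineHom]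
      have := DFunLike.congr_fun this (.ofAdd x)
      exact DFunLike.congr_fun this v
    norm_inv_lt_one := (pi_norm_lt_iff one_pos).2 fun i => by
      change ‖(D i)⁻¹‖ < 1
      rw [norm_inv]
      exact inv_lt_one_of_one_lt₀ (hD i)
    finite_ball := fun R => by
      obtain ⟨K, hK, hle⟩ := exists_norm_le_coordinates hP
      refine (isCompact_closedBall (0 : Fin d → ℤ) (K * R)).finite_of_discrete.subset
        fun x hx => ?_
      rw [mem_closedBall_zero_iff]
      exact (hle x).trans (mul_le_mul_of_nonneg_left hx hK.le)
    gap := by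
      obtain ⟨K, hK, hle⟩ := exists_norm_le_coordinates hP
      refine ⟨1 / K, one_div_pos.2 hK, fun x hx => ?_⟩
      rw [div_le_iff₀' hK]
      refine le_trans ?_ (hle x)
      obtain ⟨i, hi⟩ := Function.ne_iff.1 hx
      refine le_trans ?_ (norm_le_pi_norm x i)
      rw [Int.norm_eq_abs]
      exact_mod_cast Int.one_le_abs hi
    digits := exists_digit_bound hM }

theorem model_gens (hP : IsUnit P)
    (h : M.map (Int.cast : ℤ → ℂ) * P = P * Matrix.diagonal D) (hM : M.det ≠ 0)
    (hD : ∀ i, 1 < ‖D i‖) : (model hP h hM hD).gens = generators M := by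
  ext g
  simp [ExpandingModel.gens, model, generators, base_single, Option.exists, eq_comm]

/-- The `i`-th column of `P` is an eigenvector; this transfers the eigenvalue hypothesis to the
diagonal entries `D i`. -/
theorem hasEigenvalue_of_mul_eq {A : Matrix (Fin d) (Fin d) ℂ} (hP : IsUnit P)
    (h : A * P = P * Matrix.diagonal D) (i : Fin d) :
    Module.End.HasEigenvalue (Matrix.toLin' A) (D i) := by
  refine Module.End.hasEigenvalue_of_hasEigenvector (x := P *ᵥ Pi.single i 1) ⟨?_, ?_⟩
  · rw [Module.End.mem_eigenspace_iff, Matrix.toLin'_apply, Matrix.mulVec_mulVec, h,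
      ← Matrix.mulVec_mulVec, ← Matrix.mulVec_smul]
    congr 1
    ext j
    rcases eq_or_ne j i with rfl | hj
    · simp [Matrix.mulVec_diagonal]
    · simp [Matrix.mulVec_diagonal, hj]
  · intro h0
    have := (Matrix.mulVec_injective_of_isUnit hP) (h0.trans (Matrix.mulVec_zero P).symm)
    simpa using congrFun this i

theorem det_ne_zero_of_mul_eq (hP : IsUnit P)
    (h : M.map (Int.cast : ℤ → ℂ) * P = P * Matrix.diagonal D) (hD : ∀ i, D i ≠ 0) :
    M.det ≠ 0 := by
  intro h0
  have h1 := congrArg Matrix.det h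
  have h2 : (M.map (Int.cast : ℤ → ℂ)).det = 0 := by
    have := (Int.castRingHom ℂ).map_det M
    rw [h0, map_zero] at this
    exact this.symm
  rw [Matrix.det_mul, Matrix.det_mul, h2, zero_mul, Matrix.det_diagonal, eq_comm,
    mul_eq_zero] at h1
  rcases h1 with h1 | h1
  · exact ((Matrix.isUnit_iff_isUnit_det P).1 hP).ne_zero h1
  · exact Finset.prod_ne_zero_iff.2 (fun i _ => hD i) h1

end AbByCyclic

theorem theorem4p1 :
    (∀ (d : ℕ) (M : Matrix (Fin d) (Fin d) ℤ),
      (M.map (Int.cast : ℤ → ℂ)).IsDiagonalisable →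
      (∀ μ : ℂ, Module.End.HasEigenvalue (Matrix.toLin' (M.map (Int.cast : ℤ → ℂ))) μ → 1 < ‖μ‖) →
      ∃ C : ℕ, ∀ n : ℕ,
        conjugacyLengthFunction (AbByCyclic.generators M) n ≤ ((C * n : ℕ) : ℕ∞)) ∧
    (∀ m : ℤ, 1 < |m| →
      ∃ C : ℕ, ∀ n : ℕ,
        conjugacyLengthFunction (BaumslagSolitar.generators m) n ≤ ((C * n : ℕ) : ℕ∞)) := by
  refine ⟨fun d M ⟨P, D, hP, h⟩ hev => ?_, fun m hm => ?_⟩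
  · have hD (i : Fin d) : 1 < ‖D i‖ := hev _ (AbByCyclic.hasEigenvalue_of_mul_eq hP h i)
    have hM : M.det ≠ 0 := AbByCyclic.det_ne_zero_of_mul_eq hP h
      fun i => norm_pos_iff.1 (one_pos.trans (hD i))
    rw [← AbByCyclic.model_gens hP h hM hD]
    exact ExpandingModel.conjugacyLengthFunction_linear _
  · rw [← BaumslagSolitar.model_gens hm]
    exact ExpandingModel.conjugacyLengthFunction_linear _
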